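/- Let $\Omega=(0,1)$ and $\nu>0$. A function $y\in H^1_0(\Omega)$ is called a (weak) solution of the state equation $-\nu y''+yy'=u$ in $(0,1)$, $y(0)=y(1)=0$, with $u\in L^2(\Omega)$, if $\int_0^1(\nu y'\phi'+yy'\phi)\,dx=\int_0^1u\phi\,dx$ for all $\phi\in H^1_0(\Omega)$; similarly, $z\in H^1_0(\Omega)$ is a (weak) solution of the adjoint equation $-\nu z''-yz'=p$ in $(0,1)$, $z(0)=z(1)=0$, with $p\in L^2(\Omega)$, if $\int_0^1(\nu z'\phi'-yz'\phi)\,dx=\int_0^1p\phi\,dx$ for all $\phi\in H^1_0(\Omega)$. The state equation has exactly one solution $y=:S(u)$ for every $u\in L^2(\Omega)$, and the solution operator $S:L^2(\Omega)\to L^2(\Omega)$ so defined is Fréchet differentiable. For all $u,p\in L^2(\Omega)$, if $y=S(u)$, then the adjoint equation has exactly one solution $z$, and it satisfies $z=(S'(u))^*p$, where $S'(u):L^2(\Omega)\to L^2(\Omega)$ is the Fréchet derivative of $S$ at $u$ and $(S'(u))^*$ is its Hilbert-space adjoint. -/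

import Mathlib

open MeasureTheory
open scoped ContDiff

namespace StationaryBurgers

/-- The real Hilbert space `L²(Ω)` for `Ω = (0, 1)` with Lebesgue measure. -/
abbrev L2 : Type := Lp ℝ 2 (volume.restrict (Set.Ioo (0 : ℝ) 1))

/-- `φ` is a test function on `Ω = (0, 1)`: smooth, with compact support contained in `Ω`. -/
def IsTestFunction (φ : ℝ → ℝ) : Prop :=
  ContDiff ℝ ∞ φ ∧ HasCompactSupport φ ∧ tsupport φ ⊆ Set.Ioo (0 : ℝ) 1

/-- `g ∈ L²(Ω)` is the weak derivative of `f ∈ L²(Ω)` on `Ω = (0, 1)`. -/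
def HasWeakDeriv (f g : L2) : Prop :=
  ∀ φ : ℝ → ℝ, IsTestFunction φ →
    ∫ x in Set.Ioo (0 : ℝ) 1, f x * deriv φ x = -∫ x in Set.Ioo (0 : ℝ) 1, g x * φ x

/-- `f` satisfies the boundary condition `f(0) = f(1) = 0`: it agrees almost everywhere on
`(0, 1)` with a function that is continuous on `[0, 1]` and vanishes at `0` and at `1`. -/
def VanishesOnBoundary (f : L2) : Prop :=
  ∃ F : ℝ → ℝ, ContinuousOn F (Set.Icc (0 : ℝ) 1) ∧ F 0 = 0 ∧ F 1 = 0 ∧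
    ∀ᵐ x ∂(volume.restrict (Set.Ioo (0 : ℝ) 1)), f x = F x

/-- `f` belongs to `H¹₀(0, 1)` and `f'` is its weak derivative. -/
def InH10WithDeriv (f f' : L2) : Prop :=
  HasWeakDeriv f f' ∧ VanishesOnBoundary f

/-- `y ∈ H¹₀(0, 1)` is a weak solution of the state equation
`-ν y'' + y y' = u` in `(0, 1)`, `y(0) = y(1) = 0`. -/
def IsStateSolution (ν : ℝ) (u y : L2) : Prop :=
  ∃ y' : L2, InH10WithDeriv y y' ∧
    ∀ φ φ' : L2, InH10WithDeriv φ φ' →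
      ∫ x in Set.Ioo (0 : ℝ) 1, (ν * y' x * φ' x + y x * y' x * φ x) =
        ∫ x in Set.Ioo (0 : ℝ) 1, u x * φ x

/-- `z ∈ H¹₀(0, 1)` is a weak solution of the adjoint equation
`-ν z'' - y z' = p` in `(0, 1)`, `z(0) = z(1) = 0`. -/
def IsAdjointSolution (ν : ℝ) (y p z : L2) : Prop :=
  ∃ z' : L2, InH10WithDeriv z z' ∧
    ∀ φ φ' : L2, InH10WithDeriv φ φ' →
      ∫ x in Set.Ioo (0 : ℝ) 1, (ν * z' x * φ' x - y x * z' x * φ x) =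
        ∫ x in Set.Ioo (0 : ℝ) 1, p x * φ x

open scoped Classical in
/-- The solution operator `S : L²(Ω) → L²(Ω)` of the state equation: `S u` is the weak solution
for the right-hand side `u`. (The value `0` would be used only if there were no solution.) -/
noncomputable def solutionOperator (ν : ℝ) (u : L2) : L2 :=
  if h : ∃ y : L2, IsStateSolution ν u y then h.choose else 0

end StationaryBurgers

namespace StationaryBurgers

open Set intervalIntegral

/-- On `[0, 1]`, `F` is a primitive of the integrable function `f`. -/
structure IsPrimitive (F f : ℝ → ℝ) : Prop where
  integrable : IntervalIntegrable f volume 0 1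
  eq_add_integral : ∀ x ∈ Icc (0 : ℝ) 1, F x = F 0 + ∫ t in (0 : ℝ)..x, f t

theorem setIntegral_Ioo_eq (f : ℝ → ℝ) :
    ∫ x in Ioo (0 : ℝ) 1, f x = ∫ x in (0 : ℝ)..1, f x := by
  rw [integral_of_le zero_le_one, integral_Ioc_eq_integral_Ioo]

theorem intervalIntegrable_iff_integrable {f : ℝ → ℝ} :
    IntervalIntegrable f volume 0 1 ↔ Integrable f (volume.restrict (Ioo (0 : ℝ) 1)) :=
  intervalIntegrable_iff_integrableOn_Ioo_of_le zero_le_one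

theorem intervalIntegral_congr_ae_Ioo {f g : ℝ → ℝ}
    (h : f =ᵐ[volume.restrict (Ioo (0 : ℝ) 1)] g) {x : ℝ} (hx : x ∈ Icc (0 : ℝ) 1) :
    ∫ t in (0 : ℝ)..x, f t = ∫ t in (0 : ℝ)..x, g t := by
  rw [integral_of_le hx.1, integral_of_le hx.1, integral_Ioc_eq_integral_Ioo,
    integral_Ioc_eq_integral_Ioo]
  exact MeasureTheory.integral_congr_ae
    (ae_restrict_of_ae_restrict_of_subset (Ioo_subset_Ioo_right hx.2) h)

namespace IsPrimitive

variable {F G f g : ℝ → ℝ}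

theorem congr (hF : IsPrimitive F f) (hFG : ∀ x ∈ Icc (0 : ℝ) 1, F x = G x)
    (hfg : f =ᵐ[volume.restrict (Ioo (0 : ℝ) 1)] g) : IsPrimitive G g where
  integrable := by
    rw [intervalIntegrable_iff_integrable]
    exact (intervalIntegrable_iff_integrable.1 hF.integrable).congr hfg
  eq_add_integral x hx := by
    rw [← hFG x hx, ← hFG 0 (by simp), hF.eq_add_integral x hx,
      intervalIntegral_congr_ae_Ioo hfg hx]

theorem integral_eq_sub (hF : IsPrimitive F f) : ∫ x in Ioo (0 : ℝ) 1, f x = F 1 - F 0 := by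
  rw [setIntegral_Ioo_eq, hF.eq_add_integral 1 (by simp)]; ring

theorem exists_absolutelyContinuous (hF : IsPrimitive F f) :
    ∃ F₁ : ℝ → ℝ, AbsolutelyContinuousOnInterval F₁ 0 1 ∧ (∀ x ∈ Icc (0 : ℝ) 1, F₁ x = F x) ∧
      ∀ᵐ x, x ∈ Icc (0 : ℝ) 1 → HasDerivAt F₁ (f x) x := by
  refine ⟨fun x => F 0 + ∫ t in (0 : ℝ)..x, f t, ?_, fun x hx => (hF.eq_add_integral x hx).symm,
    ?_⟩
  · refine AbsolutelyContinuousOnInterval.add (f := fun _ => F 0) ?_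
      (hF.integrable.absolutelyContinuousOnInterval_intervalIntegral (c := 0) (by simp))
    exact contDiffOn_const.absolutelyContinuousOnInterval
  · filter_upwards [hF.integrable.ae_hasDerivAt_integral] with x hx hx'
    exact (hx (by rwa [uIcc_of_le zero_le_one]) 0 (by simp)).const_add _

theorem continuousOn (hF : IsPrimitive F f) : ContinuousOn F (Icc 0 1) := by
  obtain ⟨F₁, h, he, -⟩ := hF.exists_absolutelyContinuous
  have := h.continuousOn
  rw [uIcc_of_le zero_le_one] at this
  exact this.congr fun x hx => (he x hx).symm

/-- The product rule for absolutely continuous functions. -/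
theorem mul (hF : IsPrimitive F f) (hG : IsPrimitive G g) :
    IsPrimitive (fun x => F x * G x) (fun x => f x * G x + F x * g x) where
  integrable := by
    have h1 := hF.continuousOn
    have h2 := hG.continuousOn
    rw [← uIcc_of_le zero_le_one] at h1 h2
    exact (hF.integrable.mul_continuousOn h2).add (hG.integrable.continuousOn_mul h1)
  eq_add_integral x hx := by
    obtain ⟨F₁, hF₁, heF, hdF⟩ := hF.exists_absolutelyContinuous
    obtain ⟨G₁, hG₁, heG, hdG⟩ := hG.exists_absolutelyContinuous
    have hsub : uIcc 0 x ⊆ uIcc (0 : ℝ) 1 := by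
      rw [uIcc_of_le hx.1, uIcc_of_le zero_le_one]; exact Icc_subset_Icc_right hx.2
    have h := (hF₁.mono hsub).integral_deriv_mul_eq_sub (hG₁.mono hsub)
    rw [heF x hx, heG x hx, heF 0 (by simp), heG 0 (by simp)] at h
    have h' : ∫ t in (0 : ℝ)..x, deriv F₁ t * G₁ t + F₁ t * deriv G₁ t =
        ∫ t in (0 : ℝ)..x, f t * G t + F t * g t := by
      apply intervalIntegral.integral_congr_ae
      filter_upwards [hdF, hdG] with t hF hG ht
      have ht' : t ∈ Icc (0 : ℝ) 1 := by
        rw [← uIcc_of_le zero_le_one]; exact hsub (uIoc_subset_uIcc ht)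
      rw [(hF ht').deriv, (hG ht').deriv, heF t ht', heG t ht']
    rw [← h', h]; ring

theorem of_hasDerivAt (h : ∀ x, HasDerivAt F (f x) x) (hf : Continuous f) : IsPrimitive F f where
  integrable := hf.intervalIntegrable _ _
  eq_add_integral x hx := by
    rw [integral_eq_sub_of_hasDerivAt (fun x _ => h x) (hf.intervalIntegrable _ _)]; ring

end IsPrimitive

/-- Lebesgue measure on `Ω = (0, 1)`. -/
local notation "μΩ" => volume.restrict (Ioo (0 : ℝ) 1)

instance : IsProbabilityMeasure μΩ := ⟨by simp⟩

theorem L2.integrable (g : L2) : Integrable g μΩ := (Lp.memLp g).integrable (by norm_num)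

theorem inner_eq_integral (g h : L2) : inner ℝ g h = ∫ x in Ioo (0 : ℝ) 1, g x * h x := by
  rw [L2.inner_def]
  exact MeasureTheory.integral_congr_ae (Filter.Eventually.of_forall fun x => by simp [mul_comm])

theorem L2.integrable_mul (g h : L2) : Integrable (fun x => g x * h x) μΩ :=
  (Lp.memLp g).integrable_mul (Lp.memLp h)

/-- The constant function `1`. -/
noncomputable def one : L2 := MemLp.toLp (fun _ => 1) (memLp_const 1)

theorem coeFn_one : one =ᵐ[μΩ] fun _ => 1 := MemLp.coeFn_toLp _

theorem norm_one_L2 : ‖one‖ = 1 := by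
  rw [one, Lp.norm_toLp, eLpNorm_const _ (by norm_num) (NeZero.ne _)]
  simp

theorem inner_one (g : L2) : inner ℝ one g = ∫ x in Ioo (0 : ℝ) 1, g x := by
  rw [inner_eq_integral]
  apply MeasureTheory.integral_congr_ae
  filter_upwards [coeFn_one] with x hx
  simp [hx]

theorem norm_le_of_abs_le {g : L2} {C : ℝ} (h : ∀ᵐ x ∂μΩ, |g x| ≤ C) : ‖g‖ ≤ C := by
  have hC : 0 ≤ C := by
    obtain ⟨x, hx⟩ := h.exists
    exact (abs_nonneg _).trans hx
  have h1 : measureUnivNNReal μΩ = 1 := by simp [measureUnivNNReal]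
  simpa [h1] using Lp.norm_le_of_ae_bound (f := g) hC h

theorem integral_abs_le (g : L2) : ∫ x in Ioo (0 : ℝ) 1, |g x| ≤ ‖g‖ := by
  have h : inner ℝ one (MemLp.toLp _ (Lp.memLp g).abs) = ∫ x in Ioo (0 : ℝ) 1, |g x| := by
    rw [inner_one]; exact MeasureTheory.integral_congr_ae (MemLp.coeFn_toLp _)
  rw [← h]
  refine (real_inner_le_norm _ _).trans ?_
  rw [norm_one_L2, one_mul, Lp.norm_toLp, Lp.norm_def]
  exact le_of_eq (congrArg _ (eLpNorm_norm (g : ℝ → ℝ)))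

/-- The primitive of `g` that vanishes at `0`. The measure is restricted to `Ω` so that the value
does not depend on the representative of `g`. -/
noncomputable def primitive (g : L2) (x : ℝ) : ℝ := ∫ t in (0 : ℝ)..x, g t ∂μΩ

theorem primitive_eq (g : L2) {x : ℝ} (hx : x ∈ Icc (0 : ℝ) 1) :
    primitive g x = ∫ t in (0 : ℝ)..x, g t := by
  rw [primitive, integral_of_le hx.1, integral_of_le hx.1, Measure.restrict_restrict
    measurableSet_Ioc, integral_Ioc_eq_integral_Ioo]
  refine setIntegral_congr_set ?_
  have : (Ioc 0 x ∩ Ioo 0 1 : Set ℝ) =ᵐ[volume] (Ioc 0 x ∩ Icc 0 1 : Set ℝ) :=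
    ae_eq_set_inter (ae_eq_refl _) Ioo_ae_eq_Icc
  refine this.trans ?_
  rw [inter_eq_left.2 (Ioc_subset_Icc_self.trans (Icc_subset_Icc_right hx.2))]
  exact Ioo_ae_eq_Ioc.symm

theorem primitive_zero_right (g : L2) : primitive g 0 = 0 := by simp [primitive]

theorem isPrimitive_primitive (g : L2) : IsPrimitive (primitive g) g where
  integrable := intervalIntegrable_iff_integrable.2 (L2.integrable g)
  eq_add_integral x hx := by rw [primitive_zero_right, zero_add, primitive_eq g hx]

theorem primitive_eq_of_isPrimitive {F : ℝ → ℝ} {g : L2} (h : IsPrimitive F g) (h0 : F 0 = 0)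
    {x : ℝ} (hx : x ∈ Icc (0 : ℝ) 1) : primitive g x = F x := by
  rw [primitive_eq g hx, h.eq_add_integral x hx, h0, zero_add]

theorem primitive_one_right (g : L2) : primitive g 1 = ∫ x in Ioo (0 : ℝ) 1, g x := by
  rw [(isPrimitive_primitive g).integral_eq_sub, primitive_zero_right, sub_zero]

theorem continuous_primitive (g : L2) : Continuous (primitive g) :=
  intervalIntegral.continuous_primitive (fun _ _ => (L2.integrable g).intervalIntegrable) 0

theorem abs_primitive_le (g : L2) (x : ℝ) : |primitive g x| ≤ ‖g‖ := by
  refine le_trans ?_ (integral_abs_le g)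
  refine (norm_integral_le_integral_norm_uIoc (f := g)).trans ?_
  exact setIntegral_le_integral (L2.integrable g).norm
    (Filter.Eventually.of_forall fun _ => norm_nonneg _)

theorem primitive_add (g h : L2) (x : ℝ) :
    primitive (g + h) x = primitive g x + primitive h x := by
  rw [primitive, primitive, primitive, ← intervalIntegral.integral_add
    (L2.integrable g).intervalIntegrable (L2.integrable h).intervalIntegrable]
  apply intervalIntegral.integral_congr_ae
  filter_upwards [Lp.coeFn_add g h] with t ht _
  exact ht

theorem primitive_smul (c : ℝ) (g : L2) (x : ℝ) : primitive (c • g) x = c * primitive g x := by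
  rw [primitive, primitive, ← intervalIntegral.integral_const_mul]
  apply intervalIntegral.integral_congr_ae
  filter_upwards [Lp.coeFn_smul c g] with t ht _
  exact ht

theorem memLp_of_continuous {f : ℝ → ℝ} (hf : Continuous f) : MemLp f 2 μΩ := by
  obtain ⟨C, hC⟩ := isCompact_Icc.exists_bound_of_continuousOn (hf.continuousOn (s := Icc 0 1))
  refine MemLp.of_bound hf.aestronglyMeasurable C ?_
  filter_upwards [ae_restrict_mem measurableSet_Ioo] with x hx using hC x (Ioo_subset_Icc_self hx)

theorem memLp_mul_of_continuous {f g : ℝ → ℝ} (hf : Continuous f) (hg : MemLp g 2 μΩ) :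
    MemLp (fun x => f x * g x) 2 μΩ := by
  obtain ⟨C, hC⟩ := isCompact_Icc.exists_bound_of_continuousOn (hf.continuousOn (s := Icc 0 1))
  refine hg.of_le_mul (c := C) (hf.aestronglyMeasurable.mul hg.1) ?_
  filter_upwards [ae_restrict_mem measurableSet_Ioo] with x hx
  rw [norm_mul]
  exact mul_le_mul_of_nonneg_right (hC x (Ioo_subset_Icc_self hx)) (norm_nonneg _)

/-- The Volterra operator on `L²(0, 1)`. -/
noncomputable def volterra : L2 →L[ℝ] L2 :=
  LinearMap.mkContinuous
    { toFun := fun g => MemLp.toLp _ (memLp_of_continuous (continuous_primitive g))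
      map_add' := fun g h => by
        rw [← MemLp.toLp_add]
        exact MemLp.toLp_congr _ _ (Filter.Eventually.of_forall (primitive_add g h))
      map_smul' := fun c g => by
        rw [RingHom.id_apply, ← MemLp.toLp_const_smul]
        exact MemLp.toLp_congr _ _ (Filter.Eventually.of_forall (primitive_smul c g)) } 1
    (fun g => norm_le_of_abs_le (by
      rw [one_mul]
      filter_upwards [MemLp.coeFn_toLp (memLp_of_continuous (continuous_primitive g))] with x hx
      exact (congrArg abs hx).trans_le (abs_primitive_le g x)))

theorem coeFn_volterra (g : L2) : volterra g =ᵐ[μΩ] primitive g :=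
  MemLp.coeFn_toLp (memLp_of_continuous (continuous_primitive g))

/-- The bilinear map sending `g, h` to the product of their primitives. -/
noncomputable def primitiveMul : L2 →L[ℝ] L2 →L[ℝ] L2 :=
  LinearMap.mkContinuous₂
    (LinearMap.mk₂ ℝ
      (fun g h => MemLp.toLp (fun x => primitive g x * primitive h x)
        (memLp_of_continuous ((continuous_primitive g).mul (continuous_primitive h))))
      (fun g g' h => by
        rw [← MemLp.toLp_add]
        exact MemLp.toLp_congr _ _ (Filter.Eventually.of_forall fun x => by
          simp [primitive_add, add_mul]))
      (fun c g h => by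
        rw [← MemLp.toLp_const_smul]
        exact MemLp.toLp_congr _ _ (Filter.Eventually.of_forall fun x => by
          simp [primitive_smul, mul_assoc]))
      (fun g h h' => by
        rw [← MemLp.toLp_add]
        exact MemLp.toLp_congr _ _ (Filter.Eventually.of_forall fun x => by
          simp [primitive_add, mul_add]))
      (fun c g h => by
        rw [← MemLp.toLp_const_smul]
        exact MemLp.toLp_congr _ _ (Filter.Eventually.of_forall fun x => by
          simp [primitive_smul, mul_left_comm]))) 1
    (fun g h => norm_le_of_abs_le (by
      rw [one_mul]
      filter_upwards [MemLp.coeFn_toLp (memLp_of_continuous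
        ((continuous_primitive g).mul (continuous_primitive h)))] with x hx
      refine (congrArg abs hx).trans_le ((abs_mul _ _).trans_le ?_)
      exact mul_le_mul (abs_primitive_le g x) (abs_primitive_le h x) (abs_nonneg _)
        (norm_nonneg _)))

theorem coeFn_primitiveMul (g h : L2) :
    primitiveMul g h =ᵐ[μΩ] fun x => primitive g x * primitive h x :=
  MemLp.coeFn_toLp (memLp_of_continuous ((continuous_primitive g).mul (continuous_primitive h)))

theorem primitiveMul_comm (g h : L2) : primitiveMul g h = primitiveMul h g := by
  apply Lp.ext
  filter_upwards [coeFn_primitiveMul g h, coeFn_primitiveMul h g] with x h1 h2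
  rw [h1, h2, mul_comm]

/-- The functions of mean zero in `L²(0, 1)`. -/
noncomputable abbrev meanZero : Submodule ℝ L2 := (Submodule.span ℝ {one})ᗮ

theorem mem_meanZero {g : L2} : g ∈ meanZero ↔ ∫ x in Ioo (0 : ℝ) 1, g x = 0 := by
  rw [Submodule.mem_orthogonal_singleton_iff_inner_right, inner_one]

theorem primitive_one_of_mem {g : L2} (h : g ∈ meanZero) : primitive g 1 = 0 := by
  rw [primitive_one_right, mem_meanZero.1 h]

section QuadraticPerturbation

variable {H : Type*} [NormedAddCommGroup H] [InnerProductSpace ℝ H]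

/-- The map `g ↦ ν g - β(g, g) / 2`. -/
noncomputable def quadraticMap (ν : ℝ) (β : H →L[ℝ] H →L[ℝ] H) (g : H) : H :=
  ν • g - (1 / 2 : ℝ) • β g g

/-- The derivative `h ↦ ν h - β(g, h)` of `quadraticMap ν β` at `g`, for symmetric `β`. -/
noncomputable def linearizedMap (ν : ℝ) (β : H →L[ℝ] H →L[ℝ] H) (g : H) : H →L[ℝ] H :=
  ν • ContinuousLinearMap.id ℝ H - β g

variable {ν : ℝ} {β : H →L[ℝ] H →L[ℝ] H}

theorem linearizedMap_apply (g h : H) : linearizedMap ν β g h = ν • h - β g h := rfl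

theorem hasStrictFDerivAt_quadraticMap (hβ : ∀ g h, β g h = β h g) (g : H) :
    HasStrictFDerivAt (quadraticMap ν β) (linearizedMap ν β g) g := by
  have h1 : HasStrictFDerivAt (fun g => β g g) _ g :=
    β.hasStrictFDerivAt.clm_apply (hasStrictFDerivAt_id g)
  refine (((hasStrictFDerivAt_id g).const_smul ν).sub (h1.const_smul (1 / 2 : ℝ))).congr_fderiv ?_
  ext h
  simp [linearizedMap, hβ h g]
  module

theorem quadraticMap_sub (hβ : ∀ g h, β g h = β h g) (g h : H) :
    quadraticMap ν β g - quadraticMap ν β h =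
      linearizedMap ν β ((1 / 2 : ℝ) • (g + h)) (g - h) := by
  simp only [quadraticMap, linearizedMap_apply, map_add, map_sub, map_smul, hβ h g,
    add_apply, smul_apply]
  module

theorem mul_norm_le_norm_quadraticMap (h0 : ∀ g, inner ℝ (β g g) g = 0) (g : H) :
    ν * ‖g‖ ≤ ‖quadraticMap ν β g‖ := by
  have h : inner ℝ (quadraticMap ν β g) g = ν * (‖g‖ * ‖g‖) := by
    rw [quadraticMap, inner_sub_left, inner_smul_left, inner_smul_left, h0,
      real_inner_self_eq_norm_mul_norm]
    simp
  have h' := real_inner_le_norm (quadraticMap ν β g) g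
  rw [h] at h'
  rcases (norm_nonneg g).eq_or_lt with hg | hg
  · rw [← hg]; simp
  · nlinarith

theorem norm_sub_le_of_linearizedMap_bound (hβ : ∀ g h, β g h = β h g) {R C : ℝ}
    (hC : ∀ g, ‖g‖ ≤ R → ∀ h, ‖h‖ ≤ C * ‖linearizedMap ν β g h‖) {g h : H} (hg : ‖g‖ ≤ R)
    (hh : ‖h‖ ≤ R) : ‖g - h‖ ≤ C * ‖quadraticMap ν β g - quadraticMap ν β h‖ := by
  rw [quadraticMap_sub hβ]
  refine hC _ ?_ _
  rw [norm_smul]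
  have := norm_add_le g h
  norm_num
  linarith

/-- If all derivatives of the quadratic map are onto and bounded below, locally uniformly, then it
has a differentiable inverse. -/
theorem exists_inverse_quadraticMap [CompleteSpace H] (hν : 0 < ν) (hβ : ∀ g h, β g h = β h g)
    (h0 : ∀ g, inner ℝ (β g g) g = 0)
    (hbound : ∀ R, ∃ C, ∀ g, ‖g‖ ≤ R → ∀ h, ‖h‖ ≤ C * ‖linearizedMap ν β g h‖)
    (hsurj : ∀ g, Function.Surjective (linearizedMap ν β g)) :
    ∃ (D : H → H ≃L[ℝ] H) (Ψ : H → H), (∀ g, (D g : H →L[ℝ] H) = linearizedMap ν β g) ∧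
      (∀ g r, quadraticMap ν β g = r ↔ g = Ψ r) ∧
      ∀ r, HasFDerivAt Ψ ((D (Ψ r)).symm : H →L[ℝ] H) r := by
  have hinj : ∀ g, Function.Injective (linearizedMap ν β g) := fun g => by
    obtain ⟨C, hC⟩ := hbound ‖g‖
    refine (injective_iff_map_eq_zero _).2 fun h hh => ?_
    have := hC g le_rfl h
    rw [hh, norm_zero, mul_zero] at this
    exact norm_le_zero_iff.1 this
  let D : H → H ≃L[ℝ] H := fun g => ContinuousLinearEquiv.ofBijective (linearizedMap ν β g)
    (LinearMap.ker_eq_bot.2 (hinj g)) (LinearMap.range_eq_top.2 (hsurj g))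
  have hD : ∀ g, (D g : H →L[ℝ] H) = linearizedMap ν β g := fun g =>
    ContinuousLinearEquiv.coe_ofBijective _ _ _
  have hderiv : ∀ g, HasStrictFDerivAt (quadraticMap ν β) (D g : H →L[ℝ] H) g := fun g => by
    rw [hD]; exact hasStrictFDerivAt_quadraticMap hβ g
  have hopen : IsOpenMap (quadraticMap ν β) := isOpenMap_of_hasStrictFDerivAt_equiv hderiv
  have hcont : Continuous (quadraticMap ν β) :=
    continuous_iff_continuousAt.2 fun g => (hderiv g).continuousAt
  have hGinj : Function.Injective (quadraticMap ν β) := fun g h hgh => by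
    obtain ⟨C, hC⟩ := hbound (max ‖g‖ ‖h‖)
    have := norm_sub_le_of_linearizedMap_bound hβ hC (le_max_left _ _) (le_max_right ‖g‖ ‖h‖)
    rw [hgh, sub_self, norm_zero, mul_zero] at this
    exact sub_eq_zero.1 (norm_le_zero_iff.1 this)
  have hclosed : IsClosed (Set.range (quadraticMap ν β)) := by
    refine isClosed_of_closure_subset fun r hr => ?_
    obtain ⟨s, hs, hlim⟩ := mem_closure_iff_seq_limit.1 hr
    choose g hg using hs
    obtain ⟨M, hM⟩ := hlim.norm.bddAbove_range
    obtain ⟨C, hC⟩ := hbound (M / ν)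
    have hgb : ∀ n, ‖g n‖ ≤ M / ν := fun n => by
      rw [le_div_iff₀ hν, mul_comm]
      refine (mul_norm_le_norm_quadraticMap h0 (g n)).trans ?_
      rw [hg]
      exact hM ⟨n, rfl⟩
    have hcs : CauchySeq g := by
      rw [Metric.cauchySeq_iff']
      intro ε hε
      obtain ⟨N, hN⟩ := Metric.cauchySeq_iff'.1 hlim.cauchySeq (ε / (|C| + 1)) (by positivity)
      refine ⟨N, fun n hn => ?_⟩
      have h1 := norm_sub_le_of_linearizedMap_bound hβ hC (hgb n) (hgb N)
      have h2 := hN n hn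
      rw [dist_eq_norm] at h2 ⊢
      rw [hg, hg] at h1
      rw [lt_div_iff₀ (by positivity)] at h2
      nlinarith [le_abs_self C, norm_nonneg (s n - s N)]
    obtain ⟨a, ha⟩ := cauchySeq_tendsto_of_complete hcs
    refine ⟨a, tendsto_nhds_unique ((hcont.tendsto a).comp ha) ?_⟩
    simpa [Function.comp_def, hg] using hlim
  have hGsurj : Function.Surjective (quadraticMap ν β) := by
    rw [← Set.range_eq_univ]
    exact IsClopen.eq_univ ⟨hclosed, hopen.isOpen_range⟩ (Set.range_nonempty _)
  let e : H ≃ₜ H :=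
    (Equiv.ofBijective _ ⟨hGinj, hGsurj⟩).toHomeomorphOfContinuousOpen hcont hopen
  have he : ∀ g, e g = quadraticMap ν β g := fun g => rfl
  refine ⟨D, e.symm, hD, fun g r => ?_, fun r => ?_⟩
  · rw [← he]
    exact ⟨fun h => by rw [← h, e.symm_apply_apply], fun h => by rw [h, e.apply_symm_apply]⟩
  · refine HasFDerivAt.of_local_left_inverse e.symm.continuous.continuousAt
      (hderiv (e.symm r)).hasFDerivAt (Filter.Eventually.of_forall fun s => ?_)
    exact e.apply_symm_apply s

end QuadraticPerturbation

/-- The bilinear map `(g, h) ↦ P(G H)` on mean-zero functions, where `G` and `H` are the primitives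
of `g` and `h`, and `P` is the projection onto the mean-zero functions. -/
noncomputable def burgersForm : meanZero →L[ℝ] meanZero →L[ℝ] meanZero :=
  (ContinuousLinearMap.compL ℝ meanZero L2 meanZero meanZero.orthogonalProjectionOnto).comp
    (primitiveMul.bilinearComp meanZero.subtypeL meanZero.subtypeL)

theorem burgersForm_apply (g h : meanZero) :
    burgersForm g h = meanZero.orthogonalProjectionOnto (primitiveMul g h) := rfl

theorem burgersForm_comm (g h : meanZero) : burgersForm g h = burgersForm h g := by
  rw [burgersForm_apply, burgersForm_apply, primitiveMul_comm]

theorem inner_burgersForm (g h k : meanZero) :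
    inner ℝ (burgersForm g h) k = ∫ x in Ioo (0 : ℝ) 1, primitive g x * primitive h x * k.1 x := by
  rw [burgersForm_apply, Submodule.inner_orthogonalProjectionOnto_eq_of_mem_right, inner_eq_integral]
  apply MeasureTheory.integral_congr_ae
  filter_upwards [coeFn_primitiveMul g h] with x hx
  rw [hx]

theorem inner_burgersForm_self (g : meanZero) : inner ℝ (burgersForm g g) g = 0 := by
  have hy := isPrimitive_primitive (g : L2)
  have h := ((hy.mul hy).mul hy).integral_eq_sub
  rw [primitive_one_of_mem g.2, primitive_zero_right] at h
  rw [inner_burgersForm]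
  have h3 : (3 : ℝ) * ∫ x in Ioo (0 : ℝ) 1, primitive g x * primitive g x * g.1 x = 0 := by
    rw [← MeasureTheory.integral_const_mul]
    refine Eq.trans (MeasureTheory.integral_congr_ae (Filter.Eventually.of_forall fun x => ?_))
      (h.trans (by ring))
    dsimp only
    ring
  linarith

theorem exists_integratingFactor {ν R : ℝ} (hν : 0 < ν) {y : ℝ → ℝ} (hy : Continuous y)
    (hR : ∀ x, |y x| ≤ R) :
    ∃ E : ℝ → ℝ, (∀ x, HasDerivAt E (-(y x / ν) * E x) x) ∧ (∀ x, 0 < E x) ∧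
      ∀ x ∈ Icc (0 : ℝ) 1, Real.exp (-(R / ν)) ≤ E x ∧ E x ≤ Real.exp (R / ν) := by
  refine ⟨fun x => Real.exp (-((∫ t in (0 : ℝ)..x, y t) / ν)), fun x => ?_,
    fun x => Real.exp_pos _, fun x hx => ?_⟩
  · have h := (((hy.integral_hasStrictDerivAt 0 x).hasDerivAt.div_const ν).neg).exp
    exact h.congr_deriv (mul_comm _ _)
  · have h1 : |∫ t in (0 : ℝ)..x, y t| ≤ R := by
      have h := norm_integral_le_of_norm_le_const (a := 0) (b := x) (f := y) (C := R)
        fun t _ => hR t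
      rw [sub_zero, abs_of_nonneg hx.1] at h
      have hR0 : 0 ≤ R := (abs_nonneg _).trans (hR 0)
      exact h.trans (mul_le_of_le_one_right hR0 hx.2)
    have h2 : |(∫ t in (0 : ℝ)..x, y t) / ν| ≤ R / ν := by
      rw [abs_div, abs_of_pos hν]
      gcongr
    rw [abs_le] at h2
    exact ⟨Real.exp_le_exp.2 (by linarith), Real.exp_le_exp.2 (by linarith)⟩

theorem inner_linearizedMap_burgersForm (ν : ℝ) (g h k : meanZero) :
    inner ℝ (linearizedMap ν burgersForm g h) k =
      inner ℝ (ν • (h : L2) - primitiveMul g h) (k : L2) := by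
  rw [linearizedMap_apply, burgersForm_apply, inner_sub_left, inner_sub_left,
    Submodule.inner_orthogonalProjectionOnto_eq_of_mem_right, inner_smul_left, inner_smul_left]
  rfl

theorem linearizedMap_burgersForm_bound {ν : ℝ} (hν : 0 < ν) (R : ℝ) :
    ∃ C, ∀ g : meanZero, ‖g‖ ≤ R → ∀ h, ‖h‖ ≤ C * ‖linearizedMap ν burgersForm g h‖ := by
  set a := Real.exp (R / ν) with ha
  have ha0 : 0 < a := Real.exp_pos _
  refine ⟨a * (1 + ν⁻¹ * ‖primitiveMul‖ * R) * (a / ν), fun g hg h => ?_⟩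
  have hR : 0 ≤ R := (norm_nonneg _).trans hg
  obtain ⟨E, hE, hE0, hEb⟩ := exists_integratingFactor hν (continuous_primitive g)
    fun x => (abs_primitive_le g x).trans hg
  have hEc : Continuous E := continuous_iff_continuousAt.2 fun x => (hE x).continuousAt
  have hEc' : Continuous fun x => -(primitive g x / ν) * E x :=
    ((continuous_primitive g).div_const ν).neg.mul hEc
  have hEinv : ∀ x ∈ Icc (0 : ℝ) 1, a⁻¹ ≤ (E x)⁻¹ ∧ (E x)⁻¹ ≤ a := fun x hx => by
    refine ⟨inv_anti₀ (hE0 x) (hEb x hx).2, ?_⟩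
    rw [← inv_inv a]
    exact inv_anti₀ (inv_pos.2 ha0) (by rw [ha, ← Real.exp_neg]; exact (hEb x hx).1)
  have hprim := (IsPrimitive.of_hasDerivAt hE hEc').mul (isPrimitive_primitive h)
  have hmem : MemLp (fun x => -(primitive g x / ν) * E x * primitive h x + E x * h.1 x) 2 μΩ :=
    (memLp_of_continuous (hEc'.mul (continuous_primitive h))).add
      (memLp_mul_of_continuous hEc (Lp.memLp h.1))
  set k : L2 := hmem.toLp with hk
  have hkx := hmem.coeFn_toLp
  rw [← hk] at hkx
  have hkprim : IsPrimitive (fun x => E x * primitive h x) k :=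
    hprim.congr (fun _ _ => rfl) hkx.symm
  have hkm : k ∈ meanZero := by
    rw [mem_meanZero, hkprim.integral_eq_sub, primitive_one_of_mem h.2, primitive_zero_right]
    simp
  have hpk : ∀ x ∈ Icc (0 : ℝ) 1, primitive k x = E x * primitive h x := fun x hx =>
    primitive_eq_of_isPrimitive hkprim (by simp [primitive_zero_right]) hx
  have hq : (ν • (h : L2) - primitiveMul g h : L2) =ᵐ[μΩ] fun x => ν * (E x)⁻¹ * k x := by
    filter_upwards [Lp.coeFn_sub (ν • (h : L2)) (primitiveMul g h), Lp.coeFn_smul ν (h : L2),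
      coeFn_primitiveMul g h, hkx] with x h1 h2 h3 h4
    rw [h1, Pi.sub_apply, h2, h3, h4]
    have := (hE0 x).ne'
    simp only [Pi.smul_apply, smul_eq_mul]
    field_simp
    ring
  have hlow : ν * a⁻¹ * (‖k‖ * ‖k‖) ≤ ‖linearizedMap ν burgersForm g h‖ * ‖k‖ := by
    refine le_trans ?_ (real_inner_le_norm _ (⟨k, hkm⟩ : meanZero))
    rw [inner_linearizedMap_burgersForm, ← real_inner_self_eq_norm_mul_norm, inner_eq_integral,
      inner_eq_integral, ← MeasureTheory.integral_const_mul]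
    refine integral_mono_ae ((L2.integrable_mul k k).const_mul _) (L2.integrable_mul _ _) ?_
    filter_upwards [hq, ae_restrict_mem measurableSet_Ioo] with x hx hx'
    rw [hx, mul_assoc (ν * _)]
    have := (hEinv x (Ioo_subset_Icc_self hx')).1
    gcongr
    exact mul_self_nonneg _
  have hk1 : ‖k‖ ≤ a / ν * ‖linearizedMap ν burgersForm g h‖ := by
    rcases (norm_nonneg k).eq_or_lt with h0 | h0
    · rw [← h0]; positivity
    · rw [← mul_assoc] at hlow
      have := le_of_mul_le_mul_right hlow h0
      calc ‖k‖ = a / ν * (ν * a⁻¹ * ‖k‖) := by field_simp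
        _ ≤ _ := by gcongr
  have hh : ‖h‖ ≤ a * ‖k + ν⁻¹ • primitiveMul g k‖ := by
    refine Lp.norm_le_mul_norm_of_ae_le_mul (f := h.1) ?_
    filter_upwards [Lp.coeFn_add k (ν⁻¹ • primitiveMul g k),
      Lp.coeFn_smul ν⁻¹ (primitiveMul g k), coeFn_primitiveMul g k, hkx,
      ae_restrict_mem measurableSet_Ioo] with x h1 h2 h3 h4 hx
    have hx' := Ioo_subset_Icc_self hx
    have key : h.1 x = (E x)⁻¹ * (k + ν⁻¹ • primitiveMul g k : L2) x := by
      rw [h1, Pi.add_apply, h2, Pi.smul_apply, h3, h4, hpk x hx', smul_eq_mul]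
      have := (hE0 x).ne'
      field_simp
      ring
    rw [key, norm_mul, Real.norm_eq_abs (E x)⁻¹, abs_of_pos (inv_pos.2 (hE0 x))]
    exact mul_le_mul_of_nonneg_right (hEinv x hx').2 (norm_nonneg _)
  have hsum : ‖k + ν⁻¹ • primitiveMul g k‖ ≤ (1 + ν⁻¹ * ‖primitiveMul‖ * R) * ‖k‖ := by
    refine (norm_add_le _ _).trans ?_
    rw [norm_smul, Real.norm_eq_abs, abs_of_pos (inv_pos.2 hν), add_mul, one_mul]
    have h1 : ‖primitiveMul g k‖ ≤ ‖primitiveMul‖ * R * ‖k‖ :=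
      (primitiveMul.le_opNorm₂ g.1 k).trans (by gcongr; exact hg)
    have : ν⁻¹ * ‖primitiveMul g k‖ ≤ ν⁻¹ * (‖primitiveMul‖ * R * ‖k‖) := by gcongr
    linarith
  calc ‖h‖ ≤ a * ‖k + ν⁻¹ • primitiveMul g k‖ := hh
    _ ≤ a * ((1 + ν⁻¹ * ‖primitiveMul‖ * R) *
        (a / ν * ‖linearizedMap ν burgersForm g h‖)) := by
      gcongr
      exact hsum.trans (by gcongr)
    _ = _ := by ring

theorem linearizedMap_burgersForm_surjective {ν : ℝ} (hν : 0 < ν) (g : meanZero) :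
    Function.Surjective (linearizedMap ν burgersForm g) := fun r => by
  obtain ⟨E, hE, hE0, -⟩ := exists_integratingFactor hν (continuous_primitive g)
    (abs_primitive_le g)
  have hEc : Continuous E := continuous_iff_continuousAt.2 fun x => (hE x).continuousAt
  have hEi : ∀ x, HasDerivAt (fun x => (E x)⁻¹) (primitive g x / ν * (E x)⁻¹) x := fun x => by
    refine ((hE x).inv (hE0 x).ne').congr_deriv ?_
    have := (hE0 x).ne'
    field_simp
  have hEic : Continuous fun x => (E x)⁻¹ := hEc.inv₀ fun x => (hE0 x).ne'
  have hEic' : Continuous fun x => primitive g x / ν * (E x)⁻¹ :=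
    ((continuous_primitive g).div_const ν).mul hEic
  have hI : 0 < ∫ x in Ioo (0 : ℝ) 1, E x := by
    rw [setIntegral_Ioo_eq]
    exact intervalIntegral_pos_of_pos (hEc.intervalIntegrable _ _) hE0 zero_lt_one
  set c : ℝ := -(∫ x in Ioo (0 : ℝ) 1, E x * r.1 x) / ∫ x in Ioo (0 : ℝ) 1, E x with hc
  have hEr : MemLp (fun x => E x * r.1 x) 2 μΩ := memLp_mul_of_continuous hEc (Lp.memLp r.1)
  have hEc_int : Integrable (fun x => E x * c) μΩ :=
    (memLp_of_continuous (hEc.mul continuous_const)).integrable (by norm_num)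
  have hkmem : MemLp (fun x => ν⁻¹ * (E x * r.1 x + E x * c)) 2 μΩ :=
    (hEr.add (memLp_of_continuous (hEc.mul continuous_const))).const_mul _
  set k : L2 := hkmem.toLp with hk
  have hkx := hkmem.coeFn_toLp
  rw [← hk] at hkx
  have hkm : k ∈ meanZero := by
    rw [mem_meanZero, MeasureTheory.integral_congr_ae hkx, MeasureTheory.integral_const_mul,
      MeasureTheory.integral_add (hEr.integrable (by norm_num)) hEc_int,
      MeasureTheory.integral_mul_const, hc]
    field_simp
    ring
  have hprim := (IsPrimitive.of_hasDerivAt hEi hEic').mul (isPrimitive_primitive k)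
  have hmem : MemLp (fun x => primitive g x / ν * (E x)⁻¹ * primitive k x + (E x)⁻¹ * k x) 2 μΩ :=
    (memLp_of_continuous (hEic'.mul (continuous_primitive k))).add
      (memLp_mul_of_continuous hEic (Lp.memLp k))
  set h : L2 := hmem.toLp with hh
  have hhx := hmem.coeFn_toLp
  rw [← hh] at hhx
  have hhprim : IsPrimitive (fun x => (E x)⁻¹ * primitive k x) h :=
    hprim.congr (fun _ _ => rfl) hhx.symm
  have hhm : h ∈ meanZero := by
    rw [mem_meanZero, hhprim.integral_eq_sub, primitive_one_of_mem hkm, primitive_zero_right]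
    simp
  have hq : ν • h - primitiveMul g h = r.1 + c • one := by
    apply Lp.ext
    filter_upwards [Lp.coeFn_sub (ν • h) (primitiveMul g h), Lp.coeFn_smul ν h,
      coeFn_primitiveMul g h, hhx, hkx, Lp.coeFn_add r.1 (c • one), Lp.coeFn_smul c one,
      coeFn_one, ae_restrict_mem measurableSet_Ioo] with x h1 h2 h3 h4 h5 h6 h7 h8 hx
    rw [h1, h6, Pi.sub_apply, Pi.add_apply, h2, h7, Pi.smul_apply, Pi.smul_apply, h8, h3, h4, h5,
      primitive_eq_of_isPrimitive hhprim (by simp [primitive_zero_right])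
        (Ioo_subset_Icc_self hx)]
    have := (hE0 x).ne'
    simp only [smul_eq_mul]
    field_simp
    ring
  refine ⟨⟨h, hhm⟩, ext_inner_right ℝ fun k => ?_⟩
  rw [inner_linearizedMap_burgersForm]
  dsimp only
  rw [hq, inner_add_left, inner_smul_left, Submodule.mem_orthogonal_singleton_iff_inner_right.1 k.2]
  simp

theorem IsTestFunction.isPrimitive {φ : ℝ → ℝ} (hφ : IsTestFunction φ) :
    IsPrimitive φ (deriv φ) :=
  .of_hasDerivAt (fun x => (hφ.1.differentiable (by simp) x).hasDerivAt)
    (hφ.1.continuous_deriv (by simp))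

theorem IsTestFunction.apply_zero {φ : ℝ → ℝ} (hφ : IsTestFunction φ) : φ 0 = 0 :=
  image_eq_zero_of_notMem_tsupport fun h => lt_irrefl _ (hφ.2.2 h).1

theorem IsTestFunction.apply_one {φ : ℝ → ℝ} (hφ : IsTestFunction φ) : φ 1 = 0 :=
  image_eq_zero_of_notMem_tsupport fun h => lt_irrefl _ (hφ.2.2 h).2

theorem IsTestFunction.continuous {φ : ℝ → ℝ} (hφ : IsTestFunction φ) : Continuous φ :=
  hφ.1.continuous

theorem L2.integrable_mul_of_continuous (g : L2) {f : ℝ → ℝ} (hf : Continuous f) :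
    Integrable (fun x => g x * f x) μΩ :=
  (Lp.memLp g).integrable_mul (memLp_of_continuous hf)

/-- The primitive of a test function of mean zero is a test function. -/
theorem IsTestFunction.exists_deriv_eq {ψ : ℝ → ℝ} (hψ : IsTestFunction ψ)
    (h0 : ∫ x in (0 : ℝ)..1, ψ x = 0) : ∃ φ, IsTestFunction φ ∧ deriv φ = ψ := by
  have hd : ∀ x, HasDerivAt (fun x => ∫ t in (0 : ℝ)..x, ψ t) (ψ x) x := fun x =>
    (hψ.continuous.integral_hasStrictDerivAt 0 x).hasDerivAt
  have hderiv : deriv (fun x => ∫ t in (0 : ℝ)..x, ψ t) = ψ := funext fun x => (hd x).deriv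
  obtain ⟨a, b, ha, hb, hab⟩ : ∃ a b : ℝ, 0 < a ∧ b < 1 ∧ tsupport ψ ⊆ Icc a b := by
    rcases (tsupport ψ).eq_empty_or_nonempty with he | hne
    · exact ⟨1, 0, one_pos, one_pos, by simp [he]⟩
    · exact ⟨sInf (tsupport ψ), sSup (tsupport ψ), (hψ.2.2 (hψ.2.1.isCompact.sInf_mem hne)).1,
        (hψ.2.2 (hψ.2.1.isCompact.sSup_mem hne)).2,
        subset_Icc_csInf_csSup hψ.2.1.isCompact.bddBelow hψ.2.1.isCompact.bddAbove⟩
  have hz : ∀ t, t ∉ Icc a b → ψ t = 0 := fun t ht =>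
    image_eq_zero_of_notMem_tsupport fun h => ht (hab h)
  have hsupp : tsupport (fun x => ∫ t in (0 : ℝ)..x, ψ t) ⊆ Icc a b := by
    refine closure_minimal (fun x hx => ?_) isClosed_Icc
    by_contra hx'
    refine hx ?_
    rw [mem_Icc, not_and_or, not_le, not_le] at hx'
    have hzero : ∀ s, (∀ t ∈ uIcc s x, ψ t = 0) → ∫ t in s..x, ψ t = 0 := fun s hs => by
      rw [integral_congr (g := fun _ => 0) hs, intervalIntegral.integral_zero]
    rcases hx' with hx' | hx'
    · refine hzero 0 fun t ht => hz t fun h => ?_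
      have := ht.2.trans_lt (max_lt ha hx')
      exact absurd h.1 (not_le.2 this)
    · have : ∫ t in (1 : ℝ)..x, ψ t = 0 := hzero 1 fun t ht => hz t fun h => by
        have := (lt_min hb hx').trans_le ht.1
        exact absurd h.2 (not_le.2 this)
      dsimp only
      rw [← integral_add_adjacent_intervals (hψ.continuous.intervalIntegrable 0 1)
        (hψ.continuous.intervalIntegrable 1 x), h0, this, add_zero]
  refine ⟨_, ⟨?_, isCompact_Icc.of_isClosed_subset (isClosed_tsupport _) hsupp,
    hsupp.trans fun x hx => ⟨ha.trans_le hx.1, hx.2.trans_lt hb⟩⟩, hderiv⟩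
  rw [contDiff_infty_iff_deriv, hderiv]
  exact ⟨fun x => (hd x).differentiableAt, hψ.1⟩

theorem exists_testFunction_integral_eq_one :
    ∃ ρ, IsTestFunction ρ ∧ ∫ x in (0 : ℝ)..1, ρ x = 1 := by
  let f : ContDiffBump (1 / 2 : ℝ) := ⟨1 / 8, 1 / 4, by norm_num, by norm_num⟩
  have hs : tsupport (f.normed volume) ⊆ Ioo (0 : ℝ) 1 := by
    rw [f.tsupport_normed_eq, Real.closedBall_eq_Icc]
    intro x hx
    norm_num [f] at hx
    exact ⟨by linarith [hx.1], by linarith [hx.2]⟩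
  refine ⟨f.normed volume, ⟨f.contDiff_normed, f.hasCompactSupport_normed, hs⟩, ?_⟩
  rw [← setIntegral_Ioo_eq, setIntegral_eq_integral_of_forall_compl_eq_zero, f.integral_normed]
  exact fun x hx => image_eq_zero_of_notMem_tsupport fun h => hx (hs h)

/-- The lemma of du Bois-Reymond: if the weak derivative vanishes, the function is constant. -/
theorem exists_ae_eq_const {f : L2}
    (hf : ∀ φ, IsTestFunction φ → ∫ x in Ioo (0 : ℝ) 1, f x * deriv φ x = 0) :
    ∃ c : ℝ, ∀ᵐ x ∂μΩ, f x = c := by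
  obtain ⟨ρ, hρ, hρ1⟩ := exists_testFunction_integral_eq_one
  set c := ∫ x in Ioo (0 : ℝ) 1, f x * ρ x with hc
  refine ⟨c, ?_⟩
  have hint : Integrable (fun x => f x - c) μΩ := (L2.integrable f).sub (integrable_const c)
  have key : ∀ᵐ x ∂(volume : Measure ℝ), x ∈ Ioo (0 : ℝ) 1 → f x - c = 0 := by
    refine isOpen_Ioo.ae_eq_zero_of_integral_contDiff_smul_eq_zero
      (IntegrableOn.locallyIntegrableOn hint) fun ψ h1 h2 h3 => ?_
    have hψ : IsTestFunction ψ := ⟨h1, h2, h3⟩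
    set m := ∫ x in (0 : ℝ)..1, ψ x with hm
    have hψρ : IsTestFunction (fun x => ψ x - m * ρ x) := by
      refine ⟨h1.sub (contDiff_const.mul hρ.1), h2.sub hρ.2.1.mul_left, ?_⟩
      refine (tsupport_sub _ _).trans (union_subset h3 ?_)
      exact (tsupport_mul_subset_right).trans hρ.2.2
    obtain ⟨φ, hφ, hφ'⟩ := hψρ.exists_deriv_eq (by
      rw [intervalIntegral.integral_sub (hψ.continuous.intervalIntegrable _ _)
        ((hρ.continuous.intervalIntegrable _ _).const_mul _),
        intervalIntegral.integral_const_mul, hρ1]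
      simp [hm])
    have h4 := hf φ hφ
    rw [hφ'] at h4
    have h5 : ∫ x in Ioo (0 : ℝ) 1, f x * ψ x = m * c := by
      have : ∫ x in Ioo (0 : ℝ) 1, f x * (ψ x - m * ρ x) =
          ∫ x in Ioo (0 : ℝ) 1, (f x * ψ x - m * (f x * ρ x)) := by
        congr 1; ext x; ring
      rw [this, MeasureTheory.integral_sub (L2.integrable_mul_of_continuous f hψ.continuous)
        ((L2.integrable_mul_of_continuous f hρ.continuous).const_mul _),
        MeasureTheory.integral_const_mul] at h4
      linarith
    rw [← setIntegral_eq_integral_of_forall_compl_eq_zero (s := Ioo (0 : ℝ) 1)]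
    · have h6 : ∫ x in Ioo (0 : ℝ) 1, ψ x • (f x - c) =
          ∫ x in Ioo (0 : ℝ) 1, (f x * ψ x - c * ψ x) := by
        congr 1; ext x; simp only [smul_eq_mul]; ring
      rw [h6, MeasureTheory.integral_sub (L2.integrable_mul_of_continuous f hψ.continuous)
        (((memLp_of_continuous hψ.continuous).integrable (by norm_num)).const_mul _),
        MeasureTheory.integral_const_mul, h5, setIntegral_Ioo_eq ψ]
      ring
    · intro x hx
      rw [image_eq_zero_of_notMem_tsupport fun h => hx (h3 h), zero_smul]
  rw [ae_restrict_iff' measurableSet_Ioo]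
  filter_upwards [key] with x hx hx' using sub_eq_zero.1 (hx hx')

theorem hasWeakDeriv_volterra (g : L2) : HasWeakDeriv (volterra g) g := fun φ hφ => by
  have h := ((isPrimitive_primitive g).mul hφ.isPrimitive).integral_eq_sub
  have hint : Integrable (fun x => primitive g x * deriv φ x) μΩ :=
    ((continuous_primitive g).mul (hφ.1.continuous_deriv (by simp))).integrableOn_Icc.mono_set
      Ioo_subset_Icc_self
  rw [hφ.apply_one, hφ.apply_zero, MeasureTheory.integral_add
    (L2.integrable_mul_of_continuous g hφ.continuous) hint] at h
  have h' : ∫ x in Ioo (0 : ℝ) 1, volterra g x * deriv φ x =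
      ∫ x in Ioo (0 : ℝ) 1, primitive g x * deriv φ x := by
    apply MeasureTheory.integral_congr_ae
    filter_upwards [coeFn_volterra g] with x hx
    rw [hx]
  rw [h']
  linarith

theorem eq_of_ae_eq_Ioo {F G : ℝ → ℝ} (hF : ContinuousOn F (Icc 0 1)) (hG : ContinuousOn G (Icc 0 1))
    (h : F =ᵐ[μΩ] G) : EqOn F G (Icc 0 1) := by
  have h1 : EqOn F G (Ioo 0 1) := Measure.eqOn_open_of_ae_eq h isOpen_Ioo
    (hF.mono Ioo_subset_Icc_self) (hG.mono Ioo_subset_Icc_self)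
  refine h1.of_subset_closure hF hG Ioo_subset_Icc_self ?_
  rw [closure_Ioo zero_ne_one]

theorem inH10WithDeriv_iff {f f' : L2} :
    InH10WithDeriv f f' ↔ f' ∈ meanZero ∧ f = volterra f' := by
  constructor
  · rintro ⟨hw, F, hF, hF0, hF1, hfF⟩
    obtain ⟨c, hc⟩ := exists_ae_eq_const (f := f - volterra f') fun φ hφ => by
      have hd : Continuous (deriv φ) := hφ.1.continuous_deriv (by simp)
      have : ∫ x in Ioo (0 : ℝ) 1, (f - volterra f' : L2) x * deriv φ x =
          ∫ x in Ioo (0 : ℝ) 1, (f x * deriv φ x - volterra f' x * deriv φ x) := by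
        apply MeasureTheory.integral_congr_ae
        filter_upwards [Lp.coeFn_sub f (volterra f')] with x hx
        rw [hx, Pi.sub_apply, sub_mul]
      rw [this, MeasureTheory.integral_sub (L2.integrable_mul_of_continuous _ hd)
        (L2.integrable_mul_of_continuous _ hd), hw φ hφ, hasWeakDeriv_volterra f' φ hφ, sub_self]
    have heq : EqOn F (fun x => primitive f' x + c) (Icc 0 1) := by
      refine eq_of_ae_eq_Ioo hF ((continuous_primitive f').add continuous_const).continuousOn ?_
      filter_upwards [hc, hfF, Lp.coeFn_sub f (volterra f'), coeFn_volterra f'] with x h1 h2 h3 h4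
      rw [h3, Pi.sub_apply, h2, h4] at h1
      linarith
    have hc0 : c = 0 := by
      have := heq (x := 0) (by simp)
      simpa [hF0, primitive_zero_right] using this.symm
    subst hc0
    refine ⟨?_, ?_⟩
    · rw [mem_meanZero, ← primitive_one_right]
      have := heq (x := 1) (by simp)
      simpa [hF1] using this.symm
    · rw [← sub_eq_zero]
      apply Lp.ext
      filter_upwards [hc, Lp.coeFn_zero ℝ 2 μΩ] with x h1 h2
      rw [h1, h2]; rfl
  · rintro ⟨hm, rfl⟩
    exact ⟨hasWeakDeriv_volterra f', primitive f', (continuous_primitive f').continuousOn,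
      primitive_zero_right f', primitive_one_of_mem hm, coeFn_volterra f'⟩

theorem integral_state_form (ν : ℝ) (g k : meanZero) :
    ∫ x in Ioo (0 : ℝ) 1, (ν * g.1 x * k.1 x + volterra g x * g.1 x * volterra k x) =
      inner ℝ (quadraticMap ν burgersForm g) k := by
  have hy := isPrimitive_primitive (g : L2)
  have hprod := (hy.mul hy).mul (isPrimitive_primitive (k : L2))
  have h := hprod.integral_eq_sub
  rw [primitive_one_of_mem g.2, primitive_zero_right] at h
  have i1 : Integrable (fun x => ν * (g.1 x * k.1 x)) μΩ := (L2.integrable_mul g.1 k.1).const_mul ν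
  have i2 : Integrable (fun x => 1 / 2 * (primitive g x * primitive g x * k.1 x)) μΩ :=
    ((memLp_mul_of_continuous ((continuous_primitive g).mul (continuous_primitive g))
      (Lp.memLp k.1)).integrable (by norm_num)).const_mul _
  have i12 : Integrable (fun x => ν * (g.1 x * k.1 x) -
    1 / 2 * (primitive g x * primitive g x * k.1 x)) μΩ := i1.sub i2
  have i3 := (intervalIntegrable_iff_integrable.1 hprod.integrable).const_mul (1 / 2)
  have e : ∫ x in Ioo (0 : ℝ) 1, (ν * g.1 x * k.1 x + volterra g x * g.1 x * volterra k x) =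
      ∫ x in Ioo (0 : ℝ) 1, (ν * (g.1 x * k.1 x) -
        1 / 2 * (primitive g x * primitive g x * k.1 x) +
        1 / 2 * ((g.1 x * primitive g x + primitive g x * g.1 x) * primitive k x +
          primitive g x * primitive g x * k.1 x)) := by
    apply MeasureTheory.integral_congr_ae
    filter_upwards [coeFn_volterra g.1, coeFn_volterra k.1] with x h1 h2
    rw [h1, h2]; ring
  rw [e, MeasureTheory.integral_add i12 i3, MeasureTheory.integral_sub i1 i2,
    MeasureTheory.integral_const_mul, MeasureTheory.integral_const_mul,
    MeasureTheory.integral_const_mul, h, quadraticMap, inner_sub_left, inner_smul_left,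
    inner_smul_left, inner_burgersForm, Submodule.coe_inner, inner_eq_integral]
  simp

theorem integral_adjoint_form (ν : ℝ) (g h k : meanZero) :
    ∫ x in Ioo (0 : ℝ) 1, (ν * k.1 x * h.1 x - volterra g x * k.1 x * volterra h x) =
      inner ℝ k (linearizedMap ν burgersForm g h) := by
  rw [real_inner_comm, inner_linearizedMap_burgersForm, inner_eq_integral]
  apply MeasureTheory.integral_congr_ae
  filter_upwards [coeFn_volterra g.1, coeFn_volterra h.1, coeFn_primitiveMul g h,
    Lp.coeFn_sub (ν • h.1) (primitiveMul g h), Lp.coeFn_smul ν h.1] with x h1 h2 h3 h4 h5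
  rw [h1, h2, h4, Pi.sub_apply, h5, h3, Pi.smul_apply, smul_eq_mul]
  ring

/-- The embedding `y' ↦ y` of `H¹₀(0, 1)`, parametrized by weak derivatives, into `L²(0, 1)`. -/
noncomputable def embedding : meanZero →L[ℝ] L2 := volterra.comp meanZero.subtypeL

theorem integral_mul_volterra (u : L2) (k : meanZero) :
    ∫ x in Ioo (0 : ℝ) 1, u x * volterra k x =
      inner ℝ (ContinuousLinearMap.adjoint embedding u) k := by
  rw [ContinuousLinearMap.adjoint_inner_left, inner_eq_integral]; rfl

theorem isStateSolution_iff {ν : ℝ} {u y : L2} :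
    IsStateSolution ν u y ↔ ∃ g : meanZero, y = embedding g ∧
      quadraticMap ν burgersForm g = ContinuousLinearMap.adjoint embedding u := by
  constructor
  · rintro ⟨y', hy, h⟩
    obtain ⟨hm, rfl⟩ := inH10WithDeriv_iff.1 hy
    refine ⟨⟨y', hm⟩, rfl, ext_inner_right ℝ fun k => ?_⟩
    rw [← integral_state_form, ← integral_mul_volterra]
    exact h _ _ (inH10WithDeriv_iff.2 ⟨k.2, rfl⟩)
  · rintro ⟨g, rfl, hg⟩
    refine ⟨g, inH10WithDeriv_iff.2 ⟨g.2, rfl⟩, fun φ φ' hφ => ?_⟩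
    obtain ⟨hm, rfl⟩ := inH10WithDeriv_iff.1 hφ
    have h1 := integral_state_form ν g ⟨φ', hm⟩
    rw [hg, ← integral_mul_volterra] at h1
    exact h1

theorem isAdjointSolution_iff {ν : ℝ} {g : meanZero} {p z : L2} :
    IsAdjointSolution ν (embedding g) p z ↔ ∃ k : meanZero, z = embedding k ∧
      ContinuousLinearMap.adjoint (linearizedMap ν burgersForm g) k =
        ContinuousLinearMap.adjoint embedding p := by
  constructor
  · rintro ⟨z', hz, h⟩
    obtain ⟨hm, rfl⟩ := inH10WithDeriv_iff.1 hz
    refine ⟨⟨z', hm⟩, rfl, ext_inner_right ℝ fun k => ?_⟩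
    rw [ContinuousLinearMap.adjoint_inner_left, ← integral_adjoint_form, ← integral_mul_volterra]
    exact h _ _ (inH10WithDeriv_iff.2 ⟨k.2, rfl⟩)
  · rintro ⟨k, rfl, hk⟩
    refine ⟨k, inH10WithDeriv_iff.2 ⟨k.2, rfl⟩, fun φ φ' hφ => ?_⟩
    obtain ⟨hm, rfl⟩ := inH10WithDeriv_iff.1 hφ
    have h1 := integral_adjoint_form ν g ⟨φ', hm⟩ k
    rw [← ContinuousLinearMap.adjoint_inner_left, hk, ← integral_mul_volterra] at h1
    exact h1

theorem solutionOperator_eq {ν : ℝ} {T : L2 → L2}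
    (hT : ∀ u y, IsStateSolution ν u y ↔ y = T u) : solutionOperator ν = T := by
  funext u
  have h : ∃ y, IsStateSolution ν u y := ⟨T u, (hT u _).2 rfl⟩
  rw [solutionOperator, dif_pos h]
  exact (hT u _).1 h.choose_spec

theorem adjoint_equiv_apply_eq_iff {H : Type*} [NormedAddCommGroup H] [InnerProductSpace ℝ H]
    [CompleteSpace H] (D : H ≃L[ℝ] H) {k r : H} :
    ContinuousLinearMap.adjoint (D : H →L[ℝ] H) k = r ↔
      k = ContinuousLinearMap.adjoint (D.symm : H →L[ℝ] H) r := by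
  constructor
  · rintro rfl
    refine ext_inner_right ℝ fun h => ?_
    simp [ContinuousLinearMap.adjoint_inner_left]
  · rintro rfl
    refine ext_inner_right ℝ fun h => ?_
    simp [ContinuousLinearMap.adjoint_inner_left]

end StationaryBurgers

theorem proposition3p2 (ν : ℝ) (hν : 0 < ν) :
    -- `S` is well defined: `S u` is the one and only solution of the state equation
    (∀ u y : StationaryBurgers.L2,
      StationaryBurgers.IsStateSolution ν u y ↔ y = StationaryBurgers.solutionOperator ν u) ∧
    -- `S` is Fréchet differentiable, so that `S'(u)` is meaningful
    Differentiable ℝ (StationaryBurgers.solutionOperator ν) ∧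
    -- the adjoint equation at `y = S u` has exactly one solution `z`, and `z = (S'(u))* p`
    ∀ u p y : StationaryBurgers.L2, y = StationaryBurgers.solutionOperator ν u →
      (∃! z : StationaryBurgers.L2, StationaryBurgers.IsAdjointSolution ν y p z) ∧
      ∀ z : StationaryBurgers.L2, StationaryBurgers.IsAdjointSolution ν y p z →
        z = ContinuousLinearMap.adjoint
          (fderiv ℝ (StationaryBurgers.solutionOperator ν) u) p := by
  obtain ⟨D, Ψ, hD, hΨ, hΨ'⟩ := StationaryBurgers.exists_inverse_quadraticMap hν
    StationaryBurgers.burgersForm_comm StationaryBurgers.inner_burgersForm_self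
    (StationaryBurgers.linearizedMap_burgersForm_bound hν)
    (StationaryBurgers.linearizedMap_burgersForm_surjective hν)
  let J := StationaryBurgers.embedding
  let J' := ContinuousLinearMap.adjoint J
  have hT : ∀ u y, StationaryBurgers.IsStateSolution ν u y ↔ y = J (Ψ (J' u)) := fun u y => by
    rw [StationaryBurgers.isStateSolution_iff]
    simp only [hΨ, exists_eq_right]
    rfl
  have hS : StationaryBurgers.solutionOperator ν = fun u => J (Ψ (J' u)) :=
    StationaryBurgers.solutionOperator_eq hT
  have hderiv : ∀ u, HasFDerivAt (StationaryBurgers.solutionOperator ν)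
      (J ∘L ((D (Ψ (J' u))).symm : _ →L[ℝ] _) ∘L J') u := fun u => by
    rw [hS]
    exact J.hasFDerivAt.comp u ((hΨ' (J' u)).comp u J'.hasFDerivAt)
  refine ⟨fun u y => by rw [hT, hS], fun u => (hderiv u).differentiableAt, ?_⟩
  rintro u p y rfl
  have hz : ∀ z, StationaryBurgers.IsAdjointSolution ν (StationaryBurgers.solutionOperator ν u) p z ↔
      z = ContinuousLinearMap.adjoint (fderiv ℝ (StationaryBurgers.solutionOperator ν) u) p :=
    fun z => by
      rw [(hderiv u).fderiv, hS, StationaryBurgers.isAdjointSolution_iff]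
      simp only [← hD, StationaryBurgers.adjoint_equiv_apply_eq_iff, exists_eq_right,
        ContinuousLinearMap.adjoint_comp, ContinuousLinearMap.comp_apply]
      simp only [J', ContinuousLinearMap.adjoint_adjoint]
      rfl
  exact ⟨⟨_, (hz _).2 rfl, fun z => (hz z).1⟩, fun z => (hz z).1⟩
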